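/- A two-prover game $G=(\pi,V)$ consists of finite question sets $\mathcal X,\mathcal Y$ and answer sets $\mathcal A,\mathcal B$, a probability distribution $\pi$ on $\mathcal X\times\mathcal Y$ and a predicate $V:\mathcal A\times\mathcal B\times\mathcal X\times\mathcal Y\to\{0,1\}$. Its entangled value is $$\omega^*(G)=\lim_{d\to\infty}\ \max_{|\Psi\rangle\in\mathbb C^d\otimes\mathbb C^d}\ \max_{M,N}\ \sum_{x,y}\pi(x,y)\sum_{a,b}V(a,b,x,y)\,\langle\Psi|M_x^a\otimes N_y^b|\Psi\rangle,$$ where $|\Psi\rangle$ ranges over unit vectors and $\{M_x^a\}_{a\in\mathcal A}$ (for each $x$) and $\{N_y^b\}_{b\in\mathcal B}$ (for each $y$) range over projective measurements on $\mathbb C^d$. The $N$-fold parallel repetition $G^{\odot N}$ is the game with question sets $\mathcal X^N,\mathcal Y^N$ and answer sets $\mathcal A^N,\mathcal B^N$ in which the question pairs $(x_i,y_i)$, $i=1,\dots,N$, are drawn independently according to $\pi$, and which is won exactly if $V(a_i,b_i,x_i,y_i)=1$ for every $i$. The game $G$ is an XOR game if $\mathcal A=\mathcal B=\{0,1\}$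 and, for all $x,y$, $V(0,0,x,y)=V(1,1,x,y)$ and $V(0,1,x,y)=V(1,0,x,y)$. **Theorem.** For every XOR game $G$ and every $N\in\mathbb N$ (including $N = 0$), $$\omega^*(G^{\odot N})=\omega^*(G)^N.$$ -/

import Mathlib

open scoped Kronecker Topology

/-- A two-prover game `(π, V)`: `π` is the distribution of the pair of questions, and the provers
win on answers `a, b` to the questions `x, y` if and only if `V a b x y = true`. -/
structure TwoProverGame (X Y A B : Type*) [Fintype X] [Fintype Y] where
  π : X → Y → ℝ
  π_nonneg : ∀ x y, 0 ≤ π x y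
  π_sum : ∑ x, ∑ y, π x y = 1
  V : A → B → X → Y → Bool

/-- A projective measurement with outcomes in `A`: orthogonal projections that sum to the identity
(they are then mutually orthogonal). -/
def IsProjectiveMeasurement {n A : Type*} [Fintype n] [DecidableEq n] [Fintype A]
    (M : A → Matrix n n ℂ) : Prop :=
  (∀ a, IsStarProjection (M a)) ∧ ∑ a, M a = 1

/-- The number `⟨ψ| P ⊗ Q |ψ⟩`, which is real for Hermitian `P` and `Q`. -/
noncomputable def bornProb {m n : Type*} [Fintype m] [Fintype n] (ψ : m × n → ℂ)
    (P : Matrix m m ℂ) (Q : Matrix n n ℂ) : ℝ :=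
  (star ψ ⬝ᵥ ((P ⊗ₖ Q).mulVec ψ)).re

namespace TwoProverGame

variable {X Y A B : Type*} [Fintype X] [Fintype Y]

/-- XOR games: the answers are bits, and winning depends only on their XOR. -/
def IsXOR (G : TwoProverGame X Y (Fin 2) (Fin 2)) : Prop :=
  ∀ x y, G.V 0 0 x y = G.V 1 1 x y ∧ G.V 0 1 x y = G.V 1 0 x y

/-- The `N`-fold parallel repetition: `N` independent pairs of questions are asked at once, and
the provers win if they win every round. -/
def parallelRep (G : TwoProverGame X Y A B) (N : ℕ) :
    TwoProverGame (Fin N → X) (Fin N → Y) (Fin N → A) (Fin N → B) where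
  π x y := ∏ i, G.π (x i) (y i)
  π_nonneg x y := Finset.prod_nonneg fun i _ => G.π_nonneg (x i) (y i)
  π_sum := by
    classical
    have h1 : ∀ x : Fin N → X,
        ∑ y : Fin N → Y, ∏ i, G.π (x i) (y i) = ∏ i, ∑ y, G.π (x i) y := by
      intro x
      rw [Finset.prod_univ_sum, Fintype.piFinset_univ]
    have h2 : ∑ x : Fin N → X, ∏ i, ∑ y, G.π (x i) y = ∏ _i : Fin N, ∑ x, ∑ y, G.π x y := by
      rw [Finset.prod_univ_sum, Fintype.piFinset_univ]
    simp only [h1, h2, G.π_sum, Finset.prod_const_one]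
  V a b x y := decide (∀ i, G.V (a i) (b i) (x i) (y i) = true)

variable [Fintype A] [Fintype B]

/-- The winning probability when the provers share the state `ψ` and measure `M x` and `N y`. -/
noncomputable def winProb (G : TwoProverGame X Y A B) {d : ℕ} (ψ : Fin d × Fin d → ℂ)
    (M : X → A → Matrix (Fin d) (Fin d) ℂ) (N : Y → B → Matrix (Fin d) (Fin d) ℂ) : ℝ :=
  ∑ x, ∑ y, G.π x y * ∑ a, ∑ b, (if G.V a b x y then 1 else 0) * bornProb ψ (M x a) (N y b)

/-- The winning probabilities reachable with a unit vector in `ℂ^d ⊗ ℂ^d` and projective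
measurements. -/
def winProbs (G : TwoProverGame X Y A B) (d : ℕ) : Set ℝ :=
  {w | ∃ (ψ : Fin d × Fin d → ℂ) (M : X → A → Matrix (Fin d) (Fin d) ℂ)
      (N : Y → B → Matrix (Fin d) (Fin d) ℂ), star ψ ⬝ᵥ ψ = 1 ∧
      (∀ x, IsProjectiveMeasurement (M x)) ∧ (∀ y, IsProjectiveMeasurement (N y)) ∧
      w = G.winProb ψ M N}

/-- The largest winning probability with local dimension `d`. It is attained for `1 ≤ d`, see
`isGreatest_valueAt`. -/
noncomputable def valueAt (G : TwoProverGame X Y A B) (d : ℕ) : ℝ :=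
  sSup (G.winProbs d)

/-- The entangled value `ω*(G)`. The limit exists, see `tendsto_valueAt`. -/
noncomputable def entangledValue (G : TwoProverGame X Y A B) : ℝ :=
  Filter.limUnder Filter.atTop G.valueAt

/-! The remaining facts show that the maxima and the limit in these definitions exist. -/

lemma re_star_dotProduct_self {n : Type*} [Fintype n] (v : n → ℂ) :
    (star v ⬝ᵥ v).re = ∑ k, ‖v k‖ ^ 2 := by
  simp only [dotProduct, Complex.re_sum]
  refine Finset.sum_congr rfl fun k _ => ?_
  rw [← Complex.normSq_eq_norm_sq, Pi.star_apply, RCLike.star_def,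
    ← Complex.normSq_eq_conj_mul_self, Complex.ofReal_re]

lemma bornProb_nonneg {m n : Type*} [Fintype m] [Fintype n] (ψ : m × n → ℂ)
    {P : Matrix m m ℂ} {Q : Matrix n n ℂ} (hP : IsStarProjection P) (hQ : IsStarProjection Q) :
    0 ≤ bornProb ψ P Q := by
  set K := P ⊗ₖ Q with hK
  have h1 : K.conjTranspose = K := by
    rw [hK, Matrix.conjTranspose_kronecker]
    congr 1
    · exact hP.isSelfAdjoint
    · exact hQ.isSelfAdjoint
  have h2 : K * K = K := by
    rw [hK, ← Matrix.mul_kronecker_mul, hP.isIdempotentElem.eq, hQ.isIdempotentElem.eq]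
  have h3 : star ψ ⬝ᵥ K.mulVec ψ = star (K.mulVec ψ) ⬝ᵥ K.mulVec ψ := by
    rw [Matrix.star_mulVec, h1, ← Matrix.dotProduct_mulVec, Matrix.mulVec_mulVec, h2]
  rw [bornProb, ← hK, h3, re_star_dotProduct_self]
  exact Finset.sum_nonneg fun _ _ => sq_nonneg _

lemma sum_bornProb {d : ℕ} {ψ : Fin d × Fin d → ℂ}
    {M : A → Matrix (Fin d) (Fin d) ℂ} {N : B → Matrix (Fin d) (Fin d) ℂ}
    (hψ : star ψ ⬝ᵥ ψ = 1) (hM : IsProjectiveMeasurement M) (hN : IsProjectiveMeasurement N) :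
    ∑ a, ∑ b, bornProb ψ (M a) (N b) = 1 := by
  have h : ∑ a, ∑ b, (M a ⊗ₖ N b) = 1 := by
    have h0 : (∑ a, M a) ⊗ₖ (∑ b, N b) = 1 := by
      rw [hM.2, hN.2, Matrix.one_kronecker_one]
    rw [← h0]
    ext i j
    simp [Matrix.sum_apply, Finset.sum_mul_sum]
  have h2 : ∑ a, ∑ b, star ψ ⬝ᵥ ((M a ⊗ₖ N b).mulVec ψ) = 1 := by
    simp only [← dotProduct_sum, ← Matrix.sum_mulVec, h, Matrix.one_mulVec, hψ]
  have h3 := congrArg Complex.re h2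
  simpa only [bornProb, Complex.re_sum, Complex.one_re] using h3

lemma winProb_mem_Icc (G : TwoProverGame X Y A B) {d : ℕ} {ψ : Fin d × Fin d → ℂ}
    {M : X → A → Matrix (Fin d) (Fin d) ℂ} {N : Y → B → Matrix (Fin d) (Fin d) ℂ}
    (hψ : star ψ ⬝ᵥ ψ = 1) (hM : ∀ x, IsProjectiveMeasurement (M x))
    (hN : ∀ y, IsProjectiveMeasurement (N y)) : G.winProb ψ M N ∈ Set.Icc (0 : ℝ) 1 := by
  have h0 : ∀ x y a b, 0 ≤ bornProb ψ (M x a) (N y b) :=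
    fun x y a b => bornProb_nonneg ψ ((hM x).1 a) ((hN y).1 b)
  constructor
  · refine Finset.sum_nonneg fun x _ => Finset.sum_nonneg fun y _ =>
      mul_nonneg (G.π_nonneg x y) (Finset.sum_nonneg fun a _ => Finset.sum_nonneg fun b _ =>
        mul_nonneg ?_ (h0 x y a b))
    split_ifs <;> norm_num
  · rw [← G.π_sum]
    refine Finset.sum_le_sum fun x _ => Finset.sum_le_sum fun y _ =>
      mul_le_of_le_one_right (G.π_nonneg x y) ?_
    refine le_of_le_of_eq ?_ (sum_bornProb hψ (hM x) (hN y))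
    refine Finset.sum_le_sum fun a _ => Finset.sum_le_sum fun b _ =>
      mul_le_of_le_one_left (h0 x y a b) ?_
    split_ifs <;> norm_num

lemma bddAbove_winProbs (G : TwoProverGame X Y A B) (d : ℕ) : BddAbove (G.winProbs d) := by
  refine ⟨1, ?_⟩
  rintro w ⟨ψ, M, N, hψ, hM, hN, rfl⟩
  exact (G.winProb_mem_Icc hψ hM hN).2

lemma exists_isProjectiveMeasurement [Nonempty A] (d : ℕ) :
    ∃ M : A → Matrix (Fin d) (Fin d) ℂ, IsProjectiveMeasurement M := by
  classical
  obtain ⟨a₀⟩ := ‹Nonempty A›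
  refine ⟨fun a => if a = a₀ then 1 else 0, fun a => ?_, by simp⟩
  dsimp only
  split_ifs
  · exact .one _
  · exact .zero _

lemma winProbs_nonempty [Nonempty A] [Nonempty B] (G : TwoProverGame X Y A B) {d : ℕ}
    (hd : 1 ≤ d) : (G.winProbs d).Nonempty := by
  obtain ⟨M, hM⟩ := exists_isProjectiveMeasurement (A := A) d
  obtain ⟨N, hN⟩ := exists_isProjectiveMeasurement (A := B) d
  let i : Fin d := ⟨0, hd⟩
  exact ⟨_, Pi.single (i, i) 1, fun _ => M, fun _ => N, by simp, fun _ => hM, fun _ => hN, rfl⟩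

lemma norm_apply_le_one_of_isStarProjection {n : Type*} [Fintype n] {P : Matrix n n ℂ}
    (hP : IsStarProjection P) (i j : n) : ‖P i j‖ ≤ 1 := by
  have h1 : P.conjTranspose * P = P := by
    rw [show P.conjTranspose = P from hP.isSelfAdjoint, hP.isIdempotentElem.eq]
  have h2 : ∑ k, ‖P k j‖ ^ 2 = (P j j).re := by
    conv_rhs => rw [← h1]
    simp only [Matrix.mul_apply, Matrix.conjTranspose_apply, Complex.re_sum]
    refine Finset.sum_congr rfl fun k _ => ?_
    rw [← Complex.normSq_eq_norm_sq, RCLike.star_def, ← Complex.normSq_eq_conj_mul_self,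
      Complex.ofReal_re]
  have h3 : ∀ k, ‖P k j‖ ^ 2 ≤ (P j j).re := fun k =>
    h2 ▸ Finset.single_le_sum (f := fun k => ‖P k j‖ ^ 2) (fun _ _ => sq_nonneg _)
      (Finset.mem_univ k)
  have h4 := h3 j
  have h5 := h3 i
  have h6 := Complex.re_le_norm (P j j)
  have h7 := norm_nonneg (P j j)
  have h8 : ‖P j j‖ ≤ 1 := by nlinarith
  exact (sq_le_one_iff₀ (norm_nonneg _)).1 (h5.trans (h6.trans h8))

lemma isClosed_isProjectiveMeasurement {T : Type*} [TopologicalSpace T] {d : ℕ}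
    {f : T → A → Matrix (Fin d) (Fin d) ℂ} (hf : Continuous f) :
    IsClosed {t | IsProjectiveMeasurement (f t)} := by
  have e : {t | IsProjectiveMeasurement (f t)} = (⋂ c, {t | f t c * f t c = f t c} ∩
      {t | star (f t c) = f t c}) ∩ {t | ∑ c, f t c = 1} := by
    ext t
    simp [IsProjectiveMeasurement, isStarProjection_iff, IsIdempotentElem, IsSelfAdjoint]
  have hc : ∀ c, Continuous fun t => f t c := fun c => (continuous_apply c).comp hf
  rw [e]
  exact (isClosed_iInter fun c => (isClosed_eq ((hc c).mul (hc c)) (hc c)).inter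
    (isClosed_eq (hc c).star (hc c))).inter
    (isClosed_eq (continuous_finsetSum _ fun c _ => hc c) continuous_const)

lemma isCompact_winProbs (G : TwoProverGame X Y A B) (d : ℕ) : IsCompact (G.winProbs d) := by
  let T := (Fin d × Fin d → ℂ) × (X → A → Matrix (Fin d) (Fin d) ℂ) ×
    (Y → B → Matrix (Fin d) (Fin d) ℂ)
  let S : Set T := {t | star t.1 ⬝ᵥ t.1 = 1 ∧ (∀ x, IsProjectiveMeasurement (t.2.1 x)) ∧
    (∀ y, IsProjectiveMeasurement (t.2.2 y))}
  let D : Set (Matrix (Fin d) (Fin d) ℂ) :=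
    Set.pi Set.univ fun _ => Set.pi Set.univ fun _ => Metric.closedBall (0 : ℂ) 1
  have hD : IsCompact D :=
    isCompact_univ_pi fun _ => isCompact_univ_pi fun _ => isCompact_closedBall _ _
  have hK : IsCompact ((Set.pi Set.univ fun _ => Metric.closedBall (0 : ℂ) 1) ×ˢ
      ((Set.pi Set.univ fun _ => Set.pi Set.univ fun _ => D) ×ˢ
        (Set.pi Set.univ fun _ => Set.pi Set.univ fun _ => D)) : Set T) :=
    (isCompact_univ_pi fun _ => isCompact_closedBall _ _).prod
      ((isCompact_univ_pi fun _ => isCompact_univ_pi fun _ => hD).prod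
        (isCompact_univ_pi fun _ => isCompact_univ_pi fun _ => hD))
  have hSc : IsClosed S := by
    have e : S = {t | star t.1 ⬝ᵥ t.1 = 1} ∩ ((⋂ x, {t | IsProjectiveMeasurement (t.2.1 x)}) ∩
        (⋂ y, {t | IsProjectiveMeasurement (t.2.2 y)})) := by
      ext t; simp [S]
    rw [e]
    refine (isClosed_eq (by fun_prop) continuous_const).inter
      ((isClosed_iInter fun x => isClosed_isProjectiveMeasurement ?_).inter (isClosed_iInter fun y => isClosed_isProjectiveMeasurement ?_))
    · exact (continuous_apply x).comp (continuous_fst.comp continuous_snd)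
    · exact (continuous_apply y).comp (continuous_snd.comp continuous_snd)
  have hS : IsCompact S := by
    refine hK.of_isClosed_subset hSc ?_
    rintro ⟨ψ, M, N⟩ ⟨hψ, hM, hN⟩
    refine ⟨fun j _ => ?_, fun x _ a _ i _ j _ => ?_, fun y _ b _ i _ j _ => ?_⟩
    · have h1 : ∑ k, ‖ψ k‖ ^ 2 = 1 := by
        rw [← re_star_dotProduct_self, hψ, Complex.one_re]
      have h3 : ‖ψ j‖ ^ 2 ≤ 1 := h1 ▸ Finset.single_le_sum (f := fun k => ‖ψ k‖ ^ 2)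
        (fun _ _ => sq_nonneg _) (Finset.mem_univ j)
      rw [mem_closedBall_zero_iff]
      exact (sq_le_one_iff₀ (norm_nonneg _)).1 h3
    · exact mem_closedBall_zero_iff.2 (norm_apply_le_one_of_isStarProjection ((hM x).1 a) i j)
    · exact mem_closedBall_zero_iff.2 (norm_apply_le_one_of_isStarProjection ((hN y).1 b) i j)
  have hf : Continuous fun t : T => G.winProb t.1 t.2.1 t.2.2 := by
    have hk : ∀ x y a b, Continuous fun t : T => bornProb t.1 (t.2.1 x a) (t.2.2 y b) := by
      intro x y a b
      simp only [bornProb, dotProduct, Matrix.mulVec, Matrix.kroneckerMap_apply]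
      have e0 : ∀ k, Continuous fun t : T => t.1 k := fun k =>
        (continuous_apply k).comp continuous_fst
      have e1 : ∀ i j, Continuous fun t : T => t.2.1 x a i j := fun i j =>
        (((continuous_apply a).comp ((continuous_apply x).comp
          (continuous_fst.comp continuous_snd))).matrix_elem i j)
      have e2 : ∀ i j, Continuous fun t : T => t.2.2 y b i j := fun i j =>
        (((continuous_apply b).comp ((continuous_apply y).comp
          (continuous_snd.comp continuous_snd))).matrix_elem i j)
      exact Complex.continuous_re.comp (continuous_finsetSum _ fun k _ => (e0 k).star.mul
        (continuous_finsetSum _ fun l _ => ((e1 _ _).mul (e2 _ _)).mul (e0 l)))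
    exact continuous_finsetSum _ fun x _ => continuous_finsetSum _ fun y _ =>
      continuous_const.mul (continuous_finsetSum _ fun a _ => continuous_finsetSum _ fun b _ =>
        continuous_const.mul (hk x y a b))
  have e : G.winProbs d = (fun t : T => G.winProb t.1 t.2.1 t.2.2) '' S := by
    ext w
    constructor
    · rintro ⟨ψ, M, N, hψ, hM, hN, rfl⟩
      exact ⟨(ψ, M, N), ⟨hψ, hM, hN⟩, rfl⟩
    · rintro ⟨⟨ψ, M, N⟩, ⟨hψ, hM, hN⟩, rfl⟩
      exact ⟨ψ, M, N, hψ, hM, hN, rfl⟩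
  rw [e]
  exact hS.image hf

theorem isGreatest_valueAt [Nonempty A] [Nonempty B] (G : TwoProverGame X Y A B) {d : ℕ}
    (hd : 1 ≤ d) : IsGreatest (G.winProbs d) (G.valueAt d) :=
  (G.isCompact_winProbs d).isGreatest_sSup (G.winProbs_nonempty hd)

lemma isProjectiveMeasurement_dilate {d e : ℕ} [DecidableEq A] {M : A → Matrix (Fin d) (Fin d) ℂ}
    (hM : IsProjectiveMeasurement M) {W : Matrix (Fin e) (Fin d) ℂ}
    (hW : W.conjTranspose * W = 1) (a₀ : A) :
    IsProjectiveMeasurement fun a =>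
      W * M a * W.conjTranspose + if a = a₀ then 1 - W * W.conjTranspose else 0 := by
  have hW' : ∀ Z : Matrix (Fin d) (Fin e) ℂ, W.conjTranspose * (W * Z) = Z := fun Z => by
    rw [← Matrix.mul_assoc, hW, Matrix.one_mul]
  have hMM : ∀ a, M a * M a = M a := fun a => ((hM.1 a).isIdempotentElem).eq
  have hMM' : ∀ a (Z : Matrix (Fin d) (Fin e) ℂ), M a * (M a * Z) = M a * Z := fun a Z => by
    rw [← Matrix.mul_assoc, hMM]
  have hMs : ∀ a, (M a).conjTranspose = M a := fun a => (hM.1 a).isSelfAdjoint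
  refine ⟨fun a => ⟨?_, ?_⟩, ?_⟩
  · dsimp only [IsIdempotentElem]
    split_ifs
    · simp [mul_add, add_mul, mul_sub, sub_mul, Matrix.mul_assoc, hW', hMM']
    · simp [Matrix.mul_assoc, hW', hMM']
  · rw [IsSelfAdjoint, Matrix.star_eq_conjTranspose]
    dsimp only
    split_ifs <;> simp [Matrix.mul_assoc, hMs]
  · rw [Finset.sum_add_distrib, ← Matrix.sum_mul, ← Matrix.mul_sum, hM.2]
    simp

lemma dilate_compress {A : Type*} [DecidableEq A] {d e : ℕ} {W : Matrix (Fin e) (Fin d) ℂ}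
    (hW : W.conjTranspose * W = 1) (M : A → Matrix (Fin d) (Fin d) ℂ) (a a₀ : A) :
    W.conjTranspose * (W * M a * W.conjTranspose +
      if a = a₀ then 1 - W * W.conjTranspose else 0) * W = M a := by
  have hW' : ∀ Z : Matrix (Fin d) (Fin d) ℂ, W.conjTranspose * (W * Z) = Z := fun Z => by
    rw [← Matrix.mul_assoc, hW, Matrix.one_mul]
  split_ifs <;> simp [Matrix.mul_add, Matrix.add_mul, Matrix.mul_sub, Matrix.sub_mul,
    Matrix.mul_assoc, hW', hW]

lemma winProbs_mono [Nonempty A] [Nonempty B] (G : TwoProverGame X Y A B) {d e : ℕ}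
    (hde : d ≤ e) : G.winProbs d ⊆ G.winProbs e := by
  classical
  obtain ⟨a₀⟩ := ‹Nonempty A›
  obtain ⟨b₀⟩ := ‹Nonempty B›
  rintro w ⟨ψ, M, N, hψ, hM, hN, rfl⟩
  let W : Matrix (Fin e) (Fin d) ℂ := (1 : Matrix (Fin e) (Fin e) ℂ).submatrix id (Fin.castLE hde)
  have hW : W.conjTranspose * W = 1 := by
    ext i j
    simp [W, Matrix.mul_apply, Matrix.one_apply]
  have hWW : (W ⊗ₖ W).conjTranspose * (W ⊗ₖ W) = 1 := by
    rw [Matrix.conjTranspose_kronecker, ← Matrix.mul_kronecker_mul, hW, Matrix.one_kronecker_one]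
  have hcomp := dilate_compress (A := A) hW
  have hcomp' := dilate_compress (A := B) hW
  refine ⟨(W ⊗ₖ W).mulVec ψ,
    fun x a => W * M x a * W.conjTranspose + if a = a₀ then 1 - W * W.conjTranspose else 0,
    fun y b => W * N y b * W.conjTranspose + if b = b₀ then 1 - W * W.conjTranspose else 0,
    ?_, fun x => isProjectiveMeasurement_dilate (hM x) hW a₀,
    fun y => isProjectiveMeasurement_dilate (hN y) hW b₀, ?_⟩
  · rw [Matrix.star_mulVec, ← Matrix.dotProduct_mulVec, Matrix.mulVec_mulVec, hWW,
      Matrix.one_mulVec, hψ]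
  · have hb : ∀ x y a b, bornProb ((W ⊗ₖ W).mulVec ψ)
        (W * M x a * W.conjTranspose + if a = a₀ then 1 - W * W.conjTranspose else 0)
        (W * N y b * W.conjTranspose + if b = b₀ then 1 - W * W.conjTranspose else 0) =
        bornProb ψ (M x a) (N y b) := by
      intro x y a b
      rw [bornProb, Matrix.star_mulVec, ← Matrix.dotProduct_mulVec, Matrix.mulVec_mulVec,
        Matrix.mulVec_mulVec, Matrix.conjTranspose_kronecker, ← Matrix.mul_kronecker_mul,
        ← Matrix.mul_kronecker_mul, hcomp (M x), hcomp' (N y), bornProb]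
    simp only [winProb, hb]

theorem tendsto_valueAt [Nonempty A] [Nonempty B] (G : TwoProverGame X Y A B) :
    Filter.Tendsto G.valueAt Filter.atTop (𝓝 G.entangledValue) := by
  refine tendsto_nhds_limUnder ?_
  have hm : Monotone fun d => G.valueAt (d + 1) := fun d e hde =>
    csSup_le_csSup (G.bddAbove_winProbs _) (G.winProbs_nonempty (by omega))
      (G.winProbs_mono (by omega))
  have hb : BddAbove (Set.range fun d => G.valueAt (d + 1)) := by
    refine ⟨1, ?_⟩
    rintro w ⟨d, rfl⟩
    obtain ⟨ψ, M, N, hψ, hM, hN, h⟩ := (G.isGreatest_valueAt (Nat.le_add_left 1 d)).1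
    exact h.trans_le (G.winProb_mem_Icc hψ hM hN).2
  exact ⟨_, (Filter.tendsto_add_atTop_iff_nat 1).1 (tendsto_atTop_ciSup hm hb)⟩

end TwoProverGame

/-! In an XOR game the weighted winning predicate depends on the answers only through their XOR, so
it expands in the two characters of that bit: `π V = K₀ + K₁ χ(a) χ(b)`, with `K s = G.xorCoeff s`
and `K₀ ≥ 0`. The winning probability is thus the total of `K₀` plus the correlation of ±1-valued
observables weighted by `K₁`. For `N` rounds the predicate is a product, and expanding it gives one
term for each `s : Fin N → Fin 2`: a correlation of ±1-valued observables weighted by the tensor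
product of the `K (s i)`.

Each such correlation is bounded by semidefinite duality. A dual certificate for `K` is a pair of
diagonals `l`, `m` as in `IsBilinBound`; certificates multiply under tensor products
(`IsBilinBound.prod`) and bound every entangled correlation (`IsBilinBound.bornProb_le`). If `l s`
and `m s` both have total `t s`, the repeated game has value at most `∑ s, ∏ i, t (s i) = (t 0 + t
1) ^ N`.

It remains to find certificates with `t 0 + t 1 ≤ ω*(G)`. For `K₀` the row and column sums serve.
For `K₁`, maximize `∑ K₁ x y ⟨u x, v y⟩` over unit vectors; the marginals of the entries at an
optimum form a certificate (`isBilinBound_of_isMaxOn`), so no abstract strong duality is needed. By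
Tsirelson's construction the optimum is achieved by a quantum strategy (`IsXOR.le_entangledValue`).
The inequality `ω*(G)^N ≤ ω*(G^{⊙N})` comes from playing the rounds independently. -/

/-! ### Dual certificates and their tensor products -/

/-- The matrix `K` satisfies `∑ K x y * a x * b y ≤ (∑ l x * a x ^ 2 + ∑ m y * b y ^ 2) / 2`: the
dual constraint of the semidefinite program for the bias of an XOR game. -/
def IsBilinBound {X Y : Type*} [Fintype X] [Fintype Y] (K : X → Y → ℝ) (l : X → ℝ) (m : Y → ℝ) :
    Prop :=
  ∀ (a : X → ℝ) (b : Y → ℝ),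
    2 * ∑ x, ∑ y, K x y * (a x * b y) ≤ ∑ x, l x * a x ^ 2 + ∑ y, m y * b y ^ 2

namespace IsBilinBound

variable {X Y : Type*} [Fintype X] [Fintype Y]

/-- Both certificates used below are the two marginals of one matrix `R`, which makes the totals of
`l` and `m` agree. -/
lemma of_entries {K R : X → Y → ℝ}
    (h : ∀ (a : X → ℝ) (b : Y → ℝ),
      2 * ∑ x, ∑ y, K x y * (a x * b y) ≤ ∑ x, ∑ y, R x y * (a x ^ 2 + b y ^ 2)) :
    IsBilinBound K (fun x => ∑ y, R x y) (fun y => ∑ x, R x y) := by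
  intro a b
  refine (h a b).trans_eq ?_
  simp only [mul_add, Finset.sum_add_distrib, Finset.sum_mul]
  rw [Finset.sum_comm (f := fun x y => R x y * b y ^ 2)]

/-- Entrywise `2ab ≤ a² + b²`; this certifies the trivial-character part of the predicate. -/
lemma of_nonneg {K : X → Y → ℝ} (hK : ∀ x y, 0 ≤ K x y) :
    IsBilinBound K (fun x => ∑ y, K x y) (fun y => ∑ x, K x y) := by
  refine of_entries fun a b => ?_
  simp only [Finset.mul_sum]
  refine Finset.sum_le_sum fun x _ => Finset.sum_le_sum fun y _ => ?_
  nlinarith [mul_nonneg (hK x y) (sq_nonneg (a x - b y))]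

open scoped MatrixOrder Matrix.Norms.L2Operator in
/-- The dual constraint as a Gram representation of a positive semidefinite block matrix. -/
lemma exists_gram [DecidableEq X] [DecidableEq Y] {K : X → Y → ℝ} {l : X → ℝ} {m : Y → ℝ}
    (h : IsBilinBound K l m) :
    ∃ (g : X → X ⊕ Y → ℝ) (k : Y → X ⊕ Y → ℝ),
      (∀ x x', ∑ t, g x t * g x' t = if x = x' then l x else 0) ∧
      (∀ y y', ∑ t, k y t * k y' t = if y = y' then m y else 0) ∧
      ∀ x y, ∑ t, g x t * k y t = K x y := by
  let P : Matrix (X ⊕ Y) (X ⊕ Y) ℝ := Matrix.fromBlocks (Matrix.diagonal l) (Matrix.of K)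
    (Matrix.of K).transpose (Matrix.diagonal m)
  have hP : P.PosSemidef := by
    refine Matrix.PosSemidef.of_dotProduct_mulVec_nonneg ?_ fun v => ?_
    · ext i j
      rcases i with i | i <;> rcases j with j | j <;>
        simp [P, Matrix.diagonal_apply, eq_comm] <;> grind
    -- Changing the sign of `b` turns the upper bound on the bilinear form into positivity of the
    -- block matrix with off-diagonal blocks `+K`.
    · have := h (fun x => v (Sum.inl x)) (fun y => -v (Sum.inr y))
      have e : star v ⬝ᵥ P.mulVec v = ∑ x, l x * v (Sum.inl x) ^ 2 +
          ∑ y, m y * v (Sum.inr y) ^ 2 +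
          2 * ∑ x, ∑ y, K x y * (v (Sum.inl x) * v (Sum.inr y)) := by
        have e1 : ∑ y, ∑ x, v (Sum.inr y) * (K x y * v (Sum.inl x)) =
            ∑ x, ∑ y, K x y * (v (Sum.inl x) * v (Sum.inr y)) := by
          rw [Finset.sum_comm]
          exact Finset.sum_congr rfl fun x _ => Finset.sum_congr rfl fun y _ => by ring
        have e2 : ∑ x, ∑ y, v (Sum.inl x) * (K x y * v (Sum.inr y)) =
            ∑ x, ∑ y, K x y * (v (Sum.inl x) * v (Sum.inr y)) :=
          Finset.sum_congr rfl fun x _ => Finset.sum_congr rfl fun y _ => by ring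
        simp only [dotProduct, Matrix.mulVec, P, Fintype.sum_sum_type, Matrix.fromBlocks_apply₁₁,
          Matrix.fromBlocks_apply₁₂, Matrix.fromBlocks_apply₂₁, Matrix.fromBlocks_apply₂₂,
          Matrix.diagonal_apply, Matrix.of_apply, Matrix.transpose_apply, ite_mul, zero_mul,
          Finset.sum_ite_eq, Finset.mem_univ, if_true, Pi.star_apply, star_trivial, mul_add,
          Finset.sum_add_distrib]
        simp only [Finset.mul_sum, e1, e2]
        simp only [← Finset.mul_sum, mul_left_comm _ (l _), mul_left_comm _ (m _), ← sq]
        ring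
      rw [e]
      simp only [mul_neg, Finset.sum_neg_distrib, neg_sq] at this
      linarith
  obtain ⟨B, hB⟩ := CStarAlgebra.nonneg_iff_eq_star_mul_self.1 hP.nonneg
  have hB' : ∀ i j, ∑ t, B t i * B t j = P i j := fun i j => by
    rw [hB]; simp [Matrix.star_eq_conjTranspose, Matrix.mul_apply]
  refine ⟨fun x t => B t (Sum.inl x), fun y t => B t (Sum.inr y), fun x x' => ?_, fun y y' => ?_,
    fun x y => ?_⟩ <;> simp [hB', P, Matrix.diagonal_apply]

/-- Inner products of product vectors factor over the tensor legs; here they are extended bilinearly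
to linear combinations of product vectors. -/
lemma sum_prod_mul_sum_prod {ι Z W T : Type*} [Fintype ι] [DecidableEq ι] [Fintype Z] [Fintype W]
    [Fintype T] (p : ι → Z → T → ℝ) (q : ι → W → T → ℝ) (a : (ι → Z) → ℝ) (b : (ι → W) → ℝ) :
    ∑ t : ι → T, (∑ z, (∏ i, p i (z i) (t i)) * a z) * (∑ w, (∏ i, q i (w i) (t i)) * b w) =
      ∑ z, ∑ w, (∏ i, ∑ s, p i (z i) s * q i (w i) s) * (a z * b w) := by
  simp_rw [Finset.sum_mul_sum, Finset.prod_univ_sum, Fintype.piFinset_univ]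
  rw [Finset.sum_comm]
  refine Finset.sum_congr rfl fun z _ => ?_
  rw [Finset.sum_comm]
  refine Finset.sum_congr rfl fun w _ => ?_
  rw [Finset.sum_mul]
  refine Finset.sum_congr rfl fun t _ => ?_
  rw [Finset.prod_mul_distrib]
  ring

lemma sum_prod_ite_eq {ι Z : Type*} [Fintype ι] [DecidableEq ι] [Fintype Z] [DecidableEq Z]
    (p : ι → Z → ℝ) (a : (ι → Z) → ℝ) :
    ∑ z, ∑ w, (∏ i, if z i = w i then p i (z i) else 0) * (a z * a w) =
      ∑ z, (∏ i, p i (z i)) * a z ^ 2 := by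
  refine Finset.sum_congr rfl fun z _ => ?_
  rw [Finset.sum_eq_single z]
  · simp [sq]
  · intro w _ hw
    obtain ⟨i, hi⟩ := Function.ne_iff.1 hw
    rw [Finset.prod_eq_zero (Finset.mem_univ i) (if_neg (Ne.symm hi)), zero_mul]
  · simp

/-- The dual constraint is preserved under tensor products. -/
lemma prod {ι : Type*} [Fintype ι] [DecidableEq ι] {K : ι → X → Y → ℝ} {l : ι → X → ℝ}
    {m : ι → Y → ℝ} (h : ∀ i, IsBilinBound (K i) (l i) (m i)) :
    IsBilinBound (fun (x : ι → X) (y : ι → Y) => ∏ i, K i (x i) (y i))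
      (fun x => ∏ i, l i (x i)) (fun y => ∏ i, m i (y i)) := by
  classical
  choose g k hg hk hgk using fun i => (h i).exists_gram
  intro a b
  -- The squared norm of `∑ a x ⊗ᵢ g i (x i) - ∑ b y ⊗ᵢ k i (y i)`. Its expansion involves only the
  -- Gram entries of the factors: product diagonals in the pure terms and `∏ K i` in the cross term,
  -- so nonnegativity is the product constraint.
  have h0 : 0 ≤ ∑ t : ι → X ⊕ Y, (∑ x, (∏ i, g i (x i) (t i)) * a x -
      ∑ y, (∏ i, k i (y i) (t i)) * b y) ^ 2 := Finset.sum_nonneg fun _ _ => sq_nonneg _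
  have h1 : ∀ p q : ℝ, (p - q) ^ 2 = p * p - 2 * (p * q) + q * q := fun p q => by ring
  simp only [h1, Finset.sum_add_distrib, Finset.sum_sub_distrib, ← Finset.mul_sum,
    sum_prod_mul_sum_prod, hg, hk, hgk, sum_prod_ite_eq] at h0
  linarith

lemma re_star_dotProduct {n : Type*} [Fintype n] (w z : n → ℂ) :
    (star w ⬝ᵥ z).re = ∑ k, ((w k).re * (z k).re + (w k).im * (z k).im) := by
  simp [dotProduct, Complex.re_sum]

lemma sum_mul_re_star_dotProduct_self {Z n : Type*} [Fintype Z] [Fintype n] (c : Z → ℝ)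
    (w : Z → n → ℂ) : ∑ z, c z * (star (w z) ⬝ᵥ w z).re =
      ∑ k, (∑ z, c z * (w z k).re ^ 2 + ∑ z, c z * (w z k).im ^ 2) := by
  simp only [re_star_dotProduct, Finset.mul_sum, mul_add, ← Finset.sum_add_distrib, sq]
  rw [Finset.sum_comm]

/-- The dual constraint bounds sums of inner products of complex vectors. -/
lemma re_dotProduct_le {K : X → Y → ℝ} {l : X → ℝ} {m : Y → ℝ} (h : IsBilinBound K l m)
    {n : Type*} [Fintype n] (u : X → n → ℂ) (v : Y → n → ℂ) :
    2 * ∑ x, ∑ y, K x y * (star (u x) ⬝ᵥ v y).re ≤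
      ∑ x, l x * (star (u x) ⬝ᵥ u x).re + ∑ y, m y * (star (v y) ⬝ᵥ v y).re := by
  -- The scalar constraint is applied to the real and the imaginary part of every coordinate, and
  -- the results are added.
  have h1 := Finset.sum_le_sum fun (k : n) (_ : k ∈ Finset.univ) =>
    add_le_add (h (fun x => (u x k).re) (fun y => (v y k).re))
      (h (fun x => (u x k).im) (fun y => (v y k).im))
  have e1 : ∑ x, ∑ y, K x y * (star (u x) ⬝ᵥ v y).re = ∑ k, (∑ x, ∑ y, K x y *
      ((u x k).re * (v y k).re) + ∑ x, ∑ y, K x y * ((u x k).im * (v y k).im)) := by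
    simp only [re_star_dotProduct, Finset.mul_sum, mul_add, ← Finset.sum_add_distrib]
    rw [Finset.sum_comm (s := (Finset.univ : Finset n))]
    refine Finset.sum_congr rfl fun x _ => ?_
    rw [Finset.sum_comm]
  rw [e1, sum_mul_re_star_dotProduct_self, sum_mul_re_star_dotProduct_self, Finset.mul_sum,
    ← Finset.sum_add_distrib]
  exact (Finset.sum_le_sum fun k _ => (mul_add _ _ _).le).trans
    (h1.trans (Finset.sum_le_sum fun k _ => (add_add_add_comm _ _ _ _).le))

end IsBilinBound

/-! ### A certificate from the second variation at a vector optimum -/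

section Rotation

variable {E : Type*} [NormedAddCommGroup E] [InnerProductSpace ℝ E]

/-- The rotation of `w` towards `e`, rationally parametrized, for orthogonal unit vectors. -/
noncomputable def ratRot (e : E) (t : ℝ) (w : E) : E :=
  (1 + t ^ 2)⁻¹ • ((1 - t ^ 2) • w + (2 * t) • e)

lemma inner_ratRot {e w z : E} (he : ‖e‖ = 1) (hw : inner ℝ w e = 0) (hz : inner ℝ z e = 0)
    (s t : ℝ) : inner ℝ (ratRot e s w) (ratRot e t z) = ((1 + s ^ 2) * (1 + t ^ 2))⁻¹ *
      ((1 - s ^ 2) * (1 - t ^ 2) * inner ℝ w z + 4 * s * t) := by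
  have hz' : inner ℝ e z = 0 := by rw [real_inner_comm, hz]
  simp only [ratRot, real_inner_smul_left, real_inner_smul_right, inner_add_left, inner_add_right,
    hw, hz', real_inner_self_eq_norm_sq, he, mul_inv]
  ring

lemma norm_ratRot {e w : E} (he : ‖e‖ = 1) (hw : inner ℝ w e = 0) (h1 : ‖w‖ = 1) (t : ℝ) :
    ‖ratRot e t w‖ = 1 := by
  have h2 : ‖ratRot e t w‖ ^ 2 = 1 := by
    rw [← real_inner_self_eq_norm_sq, inner_ratRot he hw hw, real_inner_self_eq_norm_sq, h1]
    have : (1 + t ^ 2) ≠ 0 := by positivity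
    field_simp
    ring
  exact (pow_eq_one_iff_of_nonneg (norm_nonneg _) two_ne_zero).1 h2

/-- Rotate `u x` by parameter `s * a x` and `v y` by `s * b y` towards the common orthogonal
direction `e`. The objective cannot increase, and its change of order `s²` is the difference of the
two sides of the claimed constraint, up to a positive factor. -/
lemma isBilinBound_of_isMaxOn {X Y : Type*} [Fintype X] [Fintype Y] (K : X → Y → ℝ)
    {u : X → E} {v : Y → E} (hu : ∀ x, ‖u x‖ = 1) (hv : ∀ y, ‖v y‖ = 1)
    (hmax : ∀ (u' : X → E) (v' : Y → E), (∀ x, ‖u' x‖ = 1) → (∀ y, ‖v' y‖ = 1) →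
      ∑ x, ∑ y, K x y * inner ℝ (u' x) (v' y) ≤ ∑ x, ∑ y, K x y * inner ℝ (u x) (v y))
    {e : E} (he : ‖e‖ = 1) (heu : ∀ x, inner ℝ (u x) e = 0) (hev : ∀ y, inner ℝ (v y) e = 0) :
    IsBilinBound K (fun x => ∑ y, K x y * inner ℝ (u x) (v y))
      (fun y => ∑ x, K x y * inner ℝ (u x) (v y)) := by
  refine IsBilinBound.of_entries fun a b => ?_
  generalize hr : (fun x y => (inner ℝ (u x) (v y) : ℝ)) = r
  have hr' : ∀ x y, inner ℝ (u x) (v y) = r x y := fun x y => congrFun₂ hr x y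
  simp only [hr'] at hmax ⊢
  -- The rational parametrization makes the gain exactly `2 s² F s`, because `(1 - p²)(1 - q²) - (1
  -- + p²)(1 + q²) = -2(p² + q²)`. Hence `F s ≤ 0` for `s ≠ 0`, and continuity gives `F 0 ≤ 0`
  -- without Taylor expansion.
  let F : ℝ → ℝ := fun s => ∑ x, ∑ y, K x y * ((2 * (a x * b y) - (a x ^ 2 + b y ^ 2) * r x y) /
    ((1 + (s * a x) ^ 2) * (1 + (s * b y) ^ 2)))
  have hvar : ∀ s : ℝ, s ≠ 0 → F s ≤ 0 := by
    intro s hs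
    have h1 := hmax (fun x => ratRot e (s * a x) (u x)) (fun y => ratRot e (s * b y) (v y))
      (fun x => norm_ratRot he (heu x) (hu x) _) (fun y => norm_ratRot he (hev y) (hv y) _)
    simp only [fun x y => inner_ratRot he (heu x) (hev y), hr'] at h1
    have h2 : ∑ x, ∑ y, K x y * (((1 + (s * a x) ^ 2) * (1 + (s * b y) ^ 2))⁻¹ *
        ((1 - (s * a x) ^ 2) * (1 - (s * b y) ^ 2) * r x y + 4 * (s * a x) * (s * b y))) -
        ∑ x, ∑ y, K x y * r x y = (2 * s ^ 2) * F s := by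
      simp only [F, ← Finset.sum_sub_distrib, Finset.mul_sum]
      refine Finset.sum_congr rfl fun x _ => Finset.sum_congr rfl fun y _ => ?_
      have h3 : 1 + (s * a x) ^ 2 ≠ 0 := by positivity
      have h4 : 1 + (s * b y) ^ 2 ≠ 0 := by positivity
      field_simp
      ring
    have h5 : 0 < 2 * s ^ 2 := by positivity
    by_contra! h6
    nlinarith [mul_pos h5 h6]
  have hcont : Continuous F := by
    refine continuous_finsetSum _ fun x _ => continuous_finsetSum _ fun y _ =>
      continuous_const.mul (continuous_const.div (by fun_prop) fun s => ?_)
    positivity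
  have hfin : F 0 ≤ 0 := le_of_tendsto ((hcont.tendsto 0).mono_left
    (nhdsWithin_le_nhds (s := {0}ᶜ))) (Filter.eventually_of_mem self_mem_nhdsWithin hvar)
  have e1 : F 0 = 2 * ∑ x, ∑ y, K x y * (a x * b y) -
      ∑ x, ∑ y, K x y * r x y * (a x ^ 2 + b y ^ 2) := by
    simp only [F, ← Finset.sum_sub_distrib, Finset.mul_sum]
    refine Finset.sum_congr rfl fun x _ => Finset.sum_congr rfl fun y _ => ?_
    simp
    ring
  linarith

end Rotation

/-- A vector-valued optimum of a bilinear form (the bias of an XOR game) satisfies the dual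
constraint: this is the second variation in a direction orthogonal to all the vectors. -/
lemma exists_unit_vectors_isBilinBound {X Y : Type*} [Fintype X] [Fintype Y] (K : X → Y → ℝ) :
    ∃ (n : ℕ) (u : X → EuclideanSpace ℝ (Fin n)) (v : Y → EuclideanSpace ℝ (Fin n)),
      (∀ x, ‖u x‖ = 1) ∧ (∀ y, ‖v y‖ = 1) ∧
      IsBilinBound K (fun x => ∑ y, K x y * inner ℝ (u x) (v y))
        (fun y => ∑ x, K x y * inner ℝ (u x) (v y)) := by
  classical
  -- One dimension more than the number of vectors leaves a direction orthogonal to all of them.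
  let n := Fintype.card X + Fintype.card Y + 1
  let E := EuclideanSpace ℝ (Fin n)
  let S : Set ((X → E) × (Y → E)) := (Set.pi Set.univ fun _ => Metric.sphere (0 : E) 1) ×ˢ
    (Set.pi Set.univ fun _ => Metric.sphere (0 : E) 1)
  have hS : IsCompact S := (isCompact_univ_pi fun _ => isCompact_sphere _ _).prod
    (isCompact_univ_pi fun _ => isCompact_sphere _ _)
  have hne : S.Nonempty := by
    let e₀ : E := EuclideanSpace.single 0 1
    exact ⟨(fun _ => e₀, fun _ => e₀), by
      have h : ‖e₀‖ = 1 := (PiLp.norm_single _ _ _ _).trans norm_one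
      simp [S, h, Set.mem_prod]⟩
  have hc : Continuous fun p : (X → E) × (Y → E) => ∑ x, ∑ y, K x y * inner ℝ (p.1 x) (p.2 y) := by
    fun_prop
  obtain ⟨⟨u, v⟩, hmem, hmax⟩ := hS.exists_isMaxOn hne hc.continuousOn
  have hmem' : (∀ x, ‖u x‖ = 1) ∧ ∀ y, ‖v y‖ = 1 := by simpa [S, Set.mem_prod] using hmem
  obtain ⟨hu, hv⟩ := hmem'
  refine ⟨n, u, v, hu, hv, ?_⟩
  obtain ⟨e, he, heu, hev⟩ : ∃ e : E, ‖e‖ = 1 ∧ (∀ x, inner ℝ (u x) e = 0) ∧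
      ∀ y, inner ℝ (v y) e = 0 := by
    let T : Submodule ℝ E := Submodule.span ℝ (Set.range (Sum.elim u v))
    have hT : T ≠ ⊤ := by
      intro h
      have h1 : Module.finrank ℝ T ≤ Fintype.card (X ⊕ Y) := finrank_range_le_card (R := ℝ) _
      rw [h, finrank_top, finrank_euclideanSpace_fin, Fintype.card_sum] at h1
      omega
    rw [Ne, ← Submodule.orthogonal_eq_bot_iff] at hT
    obtain ⟨f, hf, hf0⟩ := Submodule.exists_mem_ne_zero_of_ne_bot hT
    have hf' : ∀ s, inner ℝ (Sum.elim u v s) f = 0 := fun s =>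
      (Submodule.mem_orthogonal _ _).1 hf _ (Submodule.subset_span ⟨s, rfl⟩)
    refine ⟨(‖f‖)⁻¹ • f, by
      rw [norm_smul, norm_inv, norm_norm, inv_mul_cancel₀ (norm_ne_zero_iff.2 hf0)], fun x => ?_, fun y => ?_⟩
    · simpa [inner_smul_right] using Or.inr (hf' (Sum.inl x))
    · simpa [inner_smul_right] using Or.inr (hf' (Sum.inr y))
  refine isBilinBound_of_isMaxOn K hu hv (fun u' v' hu' hv' => ?_) he heu hev
  exact hmax (a := (u', v')) (by simpa [S, Set.mem_prod] using ⟨hu', hv'⟩)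

/-! ### Observables and their correlations -/

lemma bornProb_sum_smul {m n A B : Type*} [Fintype m] [Fintype n] [Fintype A] [Fintype B]
    (ψ : m × n → ℂ) (M : A → Matrix m m ℂ) (N : B → Matrix n n ℂ) (f : A → ℝ) (g : B → ℝ) :
    ∑ a, ∑ b, f a * g b * bornProb ψ (M a) (N b) =
      bornProb ψ (∑ a, (f a : ℂ) • M a) (∑ b, (g b : ℂ) • N b) := by
  have h : (∑ a, (f a : ℂ) • M a) ⊗ₖ (∑ b, (g b : ℂ) • N b) =
      ∑ a, ∑ b, ((f a * g b : ℝ) : ℂ) • (M a ⊗ₖ N b) := by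
    ext i j
    simp only [Matrix.kroneckerMap_apply, Matrix.sum_apply, Matrix.smul_apply, smul_eq_mul,
      Finset.sum_mul_sum, Complex.ofReal_mul]
    exact Finset.sum_congr rfl fun a _ => Finset.sum_congr rfl fun b _ => by ring
  simp only [bornProb, h, Matrix.sum_mulVec, dotProduct_sum, Matrix.smul_mulVec, dotProduct_smul,
    Complex.re_sum, smul_eq_mul, Complex.re_ofReal_mul]

/-- By bilinearity, a predicate written as a sum of products of local functions yields a sum of
correlations of local observables. -/
lemma sum_sum_mul_bornProb {m n A B S : Type*} [Fintype m] [Fintype n] [Fintype A] [Fintype B]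
    [Fintype S] (ψ : m × n → ℂ) (M : A → Matrix m m ℂ) (N : B → Matrix n n ℂ) (c : S → ℝ)
    (f : S → A → ℝ) (g : S → B → ℝ) :
    ∑ a, ∑ b, (∑ s, c s * (f s a * g s b)) * bornProb ψ (M a) (N b) =
      ∑ s, c s * bornProb ψ (∑ a, (f s a : ℂ) • M a) (∑ b, (g s b : ℂ) • N b) := by
  simp only [← bornProb_sum_smul, Finset.mul_sum, Finset.sum_mul]
  rw [Finset.sum_comm (s := (Finset.univ : Finset S))]
  refine Finset.sum_congr rfl fun a _ => ?_
  rw [Finset.sum_comm (s := (Finset.univ : Finset S))]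
  simp only [mul_assoc]

/-- Tsirelson's observation: moving the Hermitian `P` to the left factor makes a correlation an
inner product of one vector for each prover, to which the dual constraint applies. -/
lemma bornProb_eq_re_star_dotProduct {m n : Type*} [Fintype m] [Fintype n] [DecidableEq m]
    [DecidableEq n] (ψ : m × n → ℂ) {P : Matrix m m ℂ} (hP : P.conjTranspose = P)
    (Q : Matrix n n ℂ) :
    bornProb ψ P Q = (star ((P ⊗ₖ (1 : Matrix n n ℂ)).mulVec ψ) ⬝ᵥ
      ((1 : Matrix m m ℂ) ⊗ₖ Q).mulVec ψ).re := by
  rw [bornProb, Matrix.star_mulVec, Matrix.conjTranspose_kronecker, hP,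
    Matrix.conjTranspose_one, ← Matrix.dotProduct_mulVec, Matrix.mulVec_mulVec,
    ← Matrix.mul_kronecker_mul, one_mul, mul_one]

lemma star_mulVec_dotProduct_self_of_isometry {n : Type*} [Fintype n] [DecidableEq n]
    {W : Matrix n n ℂ} (hW : W.conjTranspose * W = 1) (ψ : n → ℂ) :
    star (W.mulVec ψ) ⬝ᵥ W.mulVec ψ = star ψ ⬝ᵥ ψ := by
  rw [Matrix.star_mulVec, ← Matrix.dotProduct_mulVec, Matrix.mulVec_mulVec, hW, Matrix.one_mulVec]

namespace IsProjectiveMeasurement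

variable {n A : Type*} [Fintype n] [DecidableEq n] [Fintype A] {M : A → Matrix n n ℂ}

lemma conjTranspose_eq (hM : IsProjectiveMeasurement M) (a : A) : (M a).conjTranspose = M a :=
  (hM.1 a).isSelfAdjoint

lemma mul_self (hM : IsProjectiveMeasurement M) (a : A) : M a * M a = M a :=
  (hM.1 a).isIdempotentElem

-- Compressing `∑ M b = 1` by `M c` and cancelling the term `b = c` leaves `∑ (M b * M c)ᴴ (M b * M
-- c) = 0` over `b ≠ c`. The traces are nonnegative, so each vanishes, and with it each `M b * M c`.
open scoped ComplexOrder in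
lemma mul_eq_zero (hM : IsProjectiveMeasurement M) {a c : A} (hac : a ≠ c) : M a * M c = 0 := by
  classical
  have h1 : ∑ b, (M b * M c).conjTranspose * (M b * M c) = M c := by
    have h2 : ∀ b, (M b * M c).conjTranspose * (M b * M c) = M c * M b * M c := fun b => by
      rw [Matrix.conjTranspose_mul, hM.conjTranspose_eq, hM.conjTranspose_eq, Matrix.mul_assoc,
        ← Matrix.mul_assoc (M b), hM.mul_self, Matrix.mul_assoc]
    simp only [h2]
    rw [← Finset.sum_mul, ← Finset.mul_sum, hM.2, mul_one, hM.mul_self]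
  have h3 : ∑ b ∈ Finset.univ.erase c, (M b * M c).conjTranspose * (M b * M c) = 0 := by
    rw [← Finset.add_sum_erase _ _ (Finset.mem_univ c), hM.mul_self, hM.conjTranspose_eq,
      hM.mul_self] at h1
    simpa using h1
  have h4 := congrArg (fun Z => (Matrix.trace Z).re) h3
  simp only [Matrix.trace_sum, Complex.re_sum, Matrix.trace_zero, Complex.zero_re] at h4
  have h5 : ∀ b, 0 ≤ ((M b * M c).conjTranspose * (M b * M c)).trace := fun b =>
    (Matrix.posSemidef_conjTranspose_mul_self _).trace_nonneg
  have h6 := (Finset.sum_eq_zero_iff_of_nonneg fun b _ => (Complex.le_def.1 (h5 b)).1).1 h4 a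
    (Finset.mem_erase.2 ⟨hac, Finset.mem_univ a⟩)
  refine Matrix.trace_conjTranspose_mul_self_eq_zero_iff.1 (Complex.ext h6 ?_)
  exact (Complex.le_def.1 (h5 a)).2.symm

lemma conjTranspose_sum_smul (hM : IsProjectiveMeasurement M) (f : A → ℝ) :
    (∑ a, (f a : ℂ) • M a).conjTranspose = ∑ a, (f a : ℂ) • M a := by
  simp [Matrix.conjTranspose_sum, hM.conjTranspose_eq]

lemma sum_smul_mul_self (hM : IsProjectiveMeasurement M) {f : A → ℝ} (hf : ∀ a, f a * f a = 1) :
    (∑ a, (f a : ℂ) • M a) * (∑ a, (f a : ℂ) • M a) = 1 := by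
  classical
  rw [Finset.sum_mul_sum, ← hM.2]
  refine Finset.sum_congr rfl fun a _ => ?_
  rw [Finset.sum_eq_single a]
  · rw [Matrix.smul_mul, Matrix.mul_smul, smul_smul, ← Complex.ofReal_mul, hf, hM.mul_self]
    simp
  · intro b _ hb
    rw [Matrix.smul_mul, Matrix.mul_smul, hM.mul_eq_zero hb.symm]
    simp
  · simp

lemma submatrix {m : Type*} [Fintype m] [DecidableEq m] (hM : IsProjectiveMeasurement M)
    (e : m ≃ n) : IsProjectiveMeasurement fun a => (M a).submatrix e e := by
  refine ⟨fun a => ⟨?_, ?_⟩, ?_⟩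
  · rw [IsIdempotentElem, Matrix.submatrix_mul_equiv, hM.mul_self]
  · rw [IsSelfAdjoint, Matrix.star_eq_conjTranspose, Matrix.conjTranspose_submatrix,
      hM.conjTranspose_eq]
  · rw [← Matrix.submatrix_one_equiv e, ← hM.2]
    ext i j
    simp [Matrix.sum_apply]

end IsProjectiveMeasurement

/-- The dual constraint bounds the correlations of `±1`-valued observables. -/
lemma IsBilinBound.bornProb_le {X Y : Type*} [Fintype X] [Fintype Y] {K : X → Y → ℝ} {l : X → ℝ}
    {m : Y → ℝ} (h : IsBilinBound K l m) {p q : Type*} [Fintype p] [Fintype q] [DecidableEq p]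
    [DecidableEq q] {ψ : p × q → ℂ} (hψ : star ψ ⬝ᵥ ψ = 1) {P : X → Matrix p p ℂ}
    {Q : Y → Matrix q q ℂ} (hP : ∀ x, (P x).conjTranspose = P x) (hP1 : ∀ x, P x * P x = 1)
    (hQ : ∀ y, (Q y).conjTranspose = Q y) (hQ1 : ∀ y, Q y * Q y = 1) :
    2 * ∑ x, ∑ y, K x y * bornProb ψ (P x) (Q y) ≤ ∑ x, l x + ∑ y, m y := by
  have h1 := h.re_dotProduct_le (fun x => (P x ⊗ₖ (1 : Matrix q q ℂ)).mulVec ψ)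
    (fun y => ((1 : Matrix p p ℂ) ⊗ₖ Q y).mulVec ψ)
  have h2 : ∀ x, (P x ⊗ₖ (1 : Matrix q q ℂ)).conjTranspose * (P x ⊗ₖ (1 : Matrix q q ℂ)) = 1 := by
    intro x
    rw [Matrix.conjTranspose_kronecker, ← Matrix.mul_kronecker_mul, hP, hP1,
      Matrix.conjTranspose_one, mul_one, Matrix.one_kronecker_one]
  have h3 : ∀ y, ((1 : Matrix p p ℂ) ⊗ₖ Q y).conjTranspose * ((1 : Matrix p p ℂ) ⊗ₖ Q y) = 1 := by
    intro y
    rw [Matrix.conjTranspose_kronecker, ← Matrix.mul_kronecker_mul, hQ, hQ1,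
      Matrix.conjTranspose_one, mul_one, Matrix.one_kronecker_one]
  simp only [star_mulVec_dotProduct_self_of_isometry (h2 _),
    star_mulVec_dotProduct_self_of_isometry (h3 _), hψ, Complex.one_re, mul_one] at h1
  simpa only [← bornProb_eq_re_star_dotProduct ψ (hP _)] using h1

/-- The characters of `Fin 2`, with values `±1`. -/
noncomputable def bitChar (s a : Fin 2) : ℝ := if s = 1 ∧ a = 1 then -1 else 1

lemma bitChar_mul_self (s a : Fin 2) : bitChar s a * bitChar s a = 1 := by
  unfold bitChar; split_ifs <;> norm_num

/-! ### Character expansion of the game and the upper bound -/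

namespace TwoProverGame

variable {X Y : Type*} [Fintype X] [Fintype Y]

section Value

variable {A B : Type*} [Fintype A] [Fintype B] [Nonempty A] [Nonempty B]

lemma le_entangledValue (G : TwoProverGame X Y A B) {d : ℕ} {w : ℝ} (hw : w ∈ G.winProbs d) :
    w ≤ G.entangledValue := by
  refine ge_of_tendsto G.tendsto_valueAt ?_
  filter_upwards [Filter.eventually_ge_atTop d] with e he
  exact le_csSup (G.bddAbove_winProbs e) (G.winProbs_mono he hw)

lemma entangledValue_le (G : TwoProverGame X Y A B) {c : ℝ}
    (h : ∀ d, ∀ w ∈ G.winProbs d, w ≤ c) : G.entangledValue ≤ c := by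
  refine le_of_tendsto G.tendsto_valueAt ?_
  filter_upwards [Filter.eventually_ge_atTop 1] with d hd
  exact csSup_le (G.winProbs_nonempty hd) (h d)

/-- Strategies may use any finite index set in place of `Fin d`. -/
lemma le_entangledValue_of_fintype (G : TwoProverGame X Y A B) {ι : Type*} [Fintype ι]
    [DecidableEq ι] {ψ : ι × ι → ℂ} {M : X → A → Matrix ι ι ℂ} {N : Y → B → Matrix ι ι ℂ}
    (hψ : star ψ ⬝ᵥ ψ = 1) (hM : ∀ x, IsProjectiveMeasurement (M x))
    (hN : ∀ y, IsProjectiveMeasurement (N y)) :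
    ∑ x, ∑ y, G.π x y * ∑ a, ∑ b, (if G.V a b x y then 1 else 0) *
      bornProb ψ (M x a) (N y b) ≤ G.entangledValue := by
  let e := Fintype.equivFin ι
  refine G.le_entangledValue (d := Fintype.card ι) ⟨fun p => ψ (e.symm p.1, e.symm p.2),
    fun x a => (M x a).submatrix e.symm e.symm, fun y b => (N y b).submatrix e.symm e.symm, ?_,
    fun x => (hM x).submatrix e.symm, fun y => (hN y).submatrix e.symm, ?_⟩
  · rw [← hψ]
    exact (e.symm.prodCongr e.symm).sum_comp fun p => star (ψ p) * ψ p
  · have hb : ∀ P Q : Matrix ι ι ℂ, bornProb (fun p => ψ (e.symm p.1, e.symm p.2))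
        (P.submatrix e.symm e.symm) (Q.submatrix e.symm e.symm) = bornProb ψ P Q := by
      intro P Q
      simp only [bornProb, dotProduct, Matrix.mulVec]
      congr 1
      rw [← (e.symm.prodCongr e.symm).sum_comp]
      refine Finset.sum_congr rfl fun p _ => ?_
      rw [← (e.symm.prodCongr e.symm).sum_comp]
      rfl
    simp only [winProb, hb]

end Value

/-- The coefficients of the winning predicate, weighted with the probability of the questions, in
the basis `bitChar s a * bitChar s b`. -/
noncomputable def xorCoeff (G : TwoProverGame X Y (Fin 2) (Fin 2)) (s : Fin 2) (x : X) (y : Y) :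
    ℝ :=
  G.π x y * (((if G.V 0 0 x y then 1 else 0) + bitChar s 1 * (if G.V 0 1 x y then 1 else 0)) / 2)

/-- This coefficient averages two 0/1 values of the predicate, so `IsBilinBound.of_nonneg` applies;
the other coefficient may have either sign. -/
lemma xorCoeff_zero_nonneg (G : TwoProverGame X Y (Fin 2) (Fin 2)) (x : X) (y : Y) :
    0 ≤ G.xorCoeff 0 x y := by
  refine mul_nonneg (G.π_nonneg x y) ?_
  have : bitChar 0 1 = 1 := by simp [bitChar]
  rw [this]
  split_ifs <;> norm_num

/-- A function of the XOR alone involves only characters that are equal on both answer bits, so one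
index `s` suffices. -/
lemma IsXOR.π_mul_eq {G : TwoProverGame X Y (Fin 2) (Fin 2)} (hG : G.IsXOR) (a b : Fin 2) (x : X)
    (y : Y) : G.π x y * (if G.V a b x y then 1 else 0) =
      ∑ s, G.xorCoeff s x y * (bitChar s a * bitChar s b) := by
  obtain ⟨h0, h1⟩ := hG x y
  fin_cases a <;> fin_cases b <;> simp [xorCoeff, bitChar, h0, h1] <;> split_ifs <;> ring

/-- The winning probability of an XOR game in terms of the observables of the provers. -/
lemma IsXOR.sum_eq {G : TwoProverGame X Y (Fin 2) (Fin 2)} (hG : G.IsXOR) {ι : Type*} [Fintype ι]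
    [DecidableEq ι] (ψ : ι × ι → ℂ) (M : X → Fin 2 → Matrix ι ι ℂ)
    (N : Y → Fin 2 → Matrix ι ι ℂ) :
    ∑ x, ∑ y, G.π x y * ∑ a, ∑ b, (if G.V a b x y then 1 else 0) * bornProb ψ (M x a) (N y b) =
      ∑ s, ∑ x, ∑ y, G.xorCoeff s x y * bornProb ψ (∑ a, (bitChar s a : ℂ) • M x a)
        (∑ b, (bitChar s b : ℂ) • N y b) := by
  rw [Finset.sum_comm (s := (Finset.univ : Finset (Fin 2)))]
  refine Finset.sum_congr rfl fun x _ => ?_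
  rw [Finset.sum_comm (s := (Finset.univ : Finset (Fin 2)))]
  refine Finset.sum_congr rfl fun y _ => ?_
  rw [← sum_sum_mul_bornProb]
  simp only [Finset.mul_sum, ← mul_assoc, hG.π_mul_eq]

/-- The winning probability of the repeated game in terms of products of observables. -/
lemma IsXOR.winProb_parallelRep {G : TwoProverGame X Y (Fin 2) (Fin 2)} (hG : G.IsXOR) {N d : ℕ}
    (ψ : Fin d × Fin d → ℂ) (P : (Fin N → X) → (Fin N → Fin 2) → Matrix (Fin d) (Fin d) ℂ)
    (Q : (Fin N → Y) → (Fin N → Fin 2) → Matrix (Fin d) (Fin d) ℂ) :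
    (G.parallelRep N).winProb ψ P Q =
      ∑ s : Fin N → Fin 2, ∑ x, ∑ y, (∏ i, G.xorCoeff (s i) (x i) (y i)) *
        bornProb ψ (∑ a, ((∏ i, bitChar (s i) (a i) : ℝ) : ℂ) • P x a)
          (∑ b, ((∏ i, bitChar (s i) (b i) : ℝ) : ℂ) • Q y b) := by
  have h1 : ∀ x y a b, (G.parallelRep N).π x y *
      (if (G.parallelRep N).V a b x y then 1 else 0) =
      ∑ s : Fin N → Fin 2, (∏ i, G.xorCoeff (s i) (x i) (y i)) *
        ((∏ i, bitChar (s i) (a i)) * ∏ i, bitChar (s i) (b i)) := by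
    intro x y a b
    have h2 : (if (G.parallelRep N).V a b x y then (1 : ℝ) else 0) =
        ∏ i, if G.V (a i) (b i) (x i) (y i) then 1 else 0 := by
      simp [parallelRep, Finset.prod_ite_zero]
    rw [h2, parallelRep, ← Finset.prod_mul_distrib]
    simp only [hG.π_mul_eq, Finset.prod_univ_sum, Fintype.piFinset_univ, Finset.prod_mul_distrib]
  rw [winProb, Finset.sum_comm (s := (Finset.univ : Finset (Fin N → Fin 2)))]
  refine Finset.sum_congr rfl fun x _ => ?_
  rw [Finset.sum_comm (s := (Finset.univ : Finset (Fin N → Fin 2)))]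
  refine Finset.sum_congr rfl fun y _ => ?_
  rw [← sum_sum_mul_bornProb]
  simp only [Finset.mul_sum, ← mul_assoc, h1]

/-- Upper bound on the repeated game from dual constraints for the two coefficient matrices. -/
lemma IsXOR.entangledValue_parallelRep_le {G : TwoProverGame X Y (Fin 2) (Fin 2)} (hG : G.IsXOR)
    {l : Fin 2 → X → ℝ} {m : Fin 2 → Y → ℝ} {t : Fin 2 → ℝ}
    (h : ∀ s, IsBilinBound (G.xorCoeff s) (l s) (m s)) (hl : ∀ s, ∑ x, l s x = t s)
    (hm : ∀ s, ∑ y, m s y = t s) (N : ℕ) :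
    (G.parallelRep N).entangledValue ≤ (∑ s, t s) ^ N := by
  refine entangledValue_le _ ?_
  rintro d w ⟨ψ, P, Q, hψ, hP, hQ, rfl⟩
  -- The power is expanded over the same patterns `s` as the winning probability, so the bound can
  -- be proved pattern by pattern.
  have hsum : (∑ s, t s) ^ N = ∑ s : Fin N → Fin 2, ∏ i, t (s i) := by
    rw [← Fintype.piFinset_univ, ← Finset.prod_univ_sum]
    simp
  rw [hG.winProb_parallelRep, hsum]
  refine Finset.sum_le_sum fun s _ => ?_
  have hf : ∀ a : Fin N → Fin 2,
      (∏ i, bitChar (s i) (a i)) * (∏ i, bitChar (s i) (a i)) = 1 := fun a => by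
    simp [← Finset.prod_mul_distrib, bitChar_mul_self]
  -- A product of characters has values ±1, so the combined operators are Hermitian involutions even
  -- when `P x` and `Q y` act jointly on all rounds.
  have h1 := (IsBilinBound.prod fun i => h (s i)).bornProb_le hψ
    (fun x => (hP x).conjTranspose_sum_smul fun a => ∏ i, bitChar (s i) (a i))
    (fun x => (hP x).sum_smul_mul_self hf)
    (fun x => (hQ x).conjTranspose_sum_smul fun a => ∏ i, bitChar (s i) (a i))
    (fun x => (hQ x).sum_smul_mul_self hf)
  have h2 : ∑ x : Fin N → X, ∏ i, l (s i) (x i) = ∏ i, t (s i) := by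
    rw [← Fintype.piFinset_univ, ← Finset.prod_univ_sum]
    simp only [hl]
  have h3 : ∑ y : Fin N → Y, ∏ i, m (s i) (y i) = ∏ i, t (s i) := by
    rw [← Fintype.piFinset_univ, ← Finset.prod_univ_sum]
    simp only [hm]
  rw [h2, h3] at h1
  linarith

end TwoProverGame

/-! ### Tsirelson's construction: unit vectors as observables -/

/-- Real symmetric matrices satisfying the Clifford relations. -/
lemma exists_clifford_matrices (n : ℕ) :
    ∃ (m : Type) (_ : Fintype m) (_ : DecidableEq m) (_ : Nonempty m) (γ : Fin n → Matrix m m ℝ),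
      (∀ i, (γ i).transpose = γ i) ∧
      ∀ i j, γ i * γ j + γ j * γ i = if i = j then 2 else 0 := by
  induction n with
  | zero => exact ⟨Unit, inferInstance, inferInstance, inferInstance, fun i => i.elim0,
      fun i => i.elim0, fun i => i.elim0⟩
  | succ n ih =>
    obtain ⟨m, _, _, _, γ, hs, hc⟩ := ih
    let σx : Matrix (Fin 2) (Fin 2) ℝ := !![0, 1; 1, 0]
    let σz : Matrix (Fin 2) (Fin 2) ℝ := !![1, 0; 0, -1]
    have hxt : σx.transpose = σx := by ext i j; fin_cases i <;> fin_cases j <;> rfl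
    have hzt : σz.transpose = σz := by ext i j; fin_cases i <;> fin_cases j <;> rfl
    have hxx : σx * σx = 1 := by simp [σx, Matrix.one_fin_two]
    have hzz : σz * σz = 1 := by simp [σz, Matrix.one_fin_two]
    have hxz : σx * σz = -(σz * σx) := by simp [σx, σz]
    -- The new generator is `1 ⊗ σz`, and the old ones become `γ i ⊗ σx`; they anticommute with it
    -- because `σx` and `σz` do.
    refine ⟨m × Fin 2, inferInstance, inferInstance, inferInstance,
      Fin.cons ((1 : Matrix m m ℝ) ⊗ₖ σz) fun i => γ i ⊗ₖ σx, fun i => ?_, fun i j => ?_⟩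
    · refine Fin.cases ?_ (fun i => ?_) i
      · rw [Fin.cons_zero, ← Matrix.kroneckerMap_transpose, hzt, Matrix.transpose_one]
      · rw [Fin.cons_succ, ← Matrix.kroneckerMap_transpose, hxt, hs]
    · have hneg : ∀ A : Matrix m m ℝ, A ⊗ₖ (-(σz * σx)) = -(A ⊗ₖ (σz * σx)) := fun A => by
        ext; simp
      refine Fin.cases ?_ (fun i => ?_) i <;> refine Fin.cases ?_ (fun j => ?_) j
      · simp only [Fin.cons_zero, ← Matrix.mul_kronecker_mul, hzz, one_mul,
          Matrix.one_kronecker_one, if_true, one_add_one_eq_two]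
      · simp only [Fin.cons_zero, Fin.cons_succ, ← Matrix.mul_kronecker_mul, one_mul, mul_one,
          hxz, hneg, (Fin.succ_ne_zero j).symm, if_false, add_neg_cancel]
      · simp only [Fin.cons_zero, Fin.cons_succ, ← Matrix.mul_kronecker_mul, one_mul, mul_one,
          hxz, hneg, Fin.succ_ne_zero i, if_false, neg_add_cancel]
      · simp only [Fin.cons_succ, ← Matrix.mul_kronecker_mul, hxx, ← Matrix.add_kronecker, hc,
          Fin.succ_inj]
        split_ifs
        · rw [← one_add_one_eq_two (R := Matrix m m ℝ), Matrix.add_kronecker,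
            Matrix.one_kronecker_one, one_add_one_eq_two]
        · exact Matrix.zero_kronecker _

/-- Unit vectors are represented by symmetric involutions whose normalized trace pairing is the
inner product. -/
lemma exists_observables (n : ℕ) :
    ∃ (m : Type) (_ : Fintype m) (_ : DecidableEq m) (_ : Nonempty m)
      (U : EuclideanSpace ℝ (Fin n) → Matrix m m ℝ),
      (∀ w, (U w).transpose = U w) ∧ (∀ w, ‖w‖ = 1 → U w * U w = 1) ∧
      ∀ w z, (U w * U z).trace = Fintype.card m * inner ℝ w z := by
  obtain ⟨m, i1, i2, i3, γ, hs, hc⟩ := exists_clifford_matrices n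
  let U : EuclideanSpace ℝ (Fin n) → Matrix m m ℝ := fun w => ∑ i, w i • γ i
  -- Linearity extends the Clifford relations to all vectors. The case `w = z` of norm one makes `U
  -- w` an involution, and the trace gives the inner product.
  have hU : ∀ w z, U w * U z + U z * U w = (2 * inner ℝ w z : ℝ) • (1 : Matrix m m ℝ) := by
    intro w z
    have h1 : ∀ w z, U w * U z = ∑ i, ∑ j, (w i * z j) • (γ i * γ j) := fun w z => by
      simp only [U, Finset.sum_mul_sum, Matrix.smul_mul, Matrix.mul_smul, smul_smul]
      exact Finset.sum_congr rfl fun i _ => Finset.sum_congr rfl fun j _ => by rw [mul_comm]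
    have h2 : U z * U w = ∑ i, ∑ j, (w i * z j) • (γ j * γ i) := by
      rw [h1, Finset.sum_comm]
      exact Finset.sum_congr rfl fun i _ => Finset.sum_congr rfl fun j _ => by rw [mul_comm]
    have h3 : inner ℝ w z = ∑ i, w i * z i := by
      rw [PiLp.inner_apply]
      simp [mul_comm]
    simp only [h1 w z, h2, ← Finset.sum_add_distrib, ← smul_add, hc, smul_ite, smul_zero,
      Finset.sum_ite_eq, Finset.mem_univ, if_true, ← Finset.sum_smul, ← h3]
    rw [← one_add_one_eq_two (R := Matrix m m ℝ), smul_add, ← add_smul, ← two_mul]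
  refine ⟨m, i1, i2, i3, U, fun w => by simp [U, Matrix.transpose_sum, hs], fun w hw => ?_,
    fun w z => ?_⟩
  · have h := hU w w
    rw [real_inner_self_eq_norm_sq, hw, ← two_smul ℝ, one_pow, mul_one] at h
    exact smul_right_injective _ (two_ne_zero (α := ℝ)) h
  · have h := congrArg Matrix.trace (hU w z)
    rw [Matrix.trace_add, Matrix.trace_mul_comm (U z), Matrix.trace_smul, Matrix.trace_one,
      smul_eq_mul] at h
    linarith

/-- The maximally entangled state. -/
noncomputable def maxEntangled (m : Type*) [Fintype m] [DecidableEq m] : m × m → ℂ :=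
  fun p => if p.1 = p.2 then (((√(Fintype.card m : ℝ))⁻¹ : ℝ) : ℂ) else 0

section MaxEntangled

variable {m : Type*} [Fintype m] [DecidableEq m]

/-- On the maximally entangled state `P ⊗ Q` has expectation `tr (P Qᵀ)` over the dimension;
symmetry of `Q` removes the transpose. -/
lemma bornProb_maxEntangled (P Q : Matrix m m ℝ) (hQ : Q.transpose = Q) :
    bornProb (maxEntangled m) (P.map Complex.ofReal) (Q.map Complex.ofReal) =
      (P * Q).trace / Fintype.card m := by
  have h : (√(Fintype.card m : ℝ))⁻¹ * (√(Fintype.card m : ℝ))⁻¹ = (Fintype.card m : ℝ)⁻¹ := by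
    rw [← mul_inv, Real.mul_self_sqrt (Nat.cast_nonneg _)]
  have hQ' : ∀ i j, Q j i = Q i j := fun i j => congrFun₂ hQ i j
  have e : star (maxEntangled m) ⬝ᵥ
      ((P.map Complex.ofReal ⊗ₖ Q.map Complex.ofReal).mulVec (maxEntangled m)) =
      (((P * Q).trace / Fintype.card m : ℝ) : ℂ) := by
    simp only [dotProduct, Matrix.mulVec, maxEntangled, Fintype.sum_prod_type, Pi.star_apply,
      Matrix.kroneckerMap_apply, Matrix.map_apply, mul_ite, mul_zero, Finset.sum_ite_eq,
      Finset.mem_univ, if_true, apply_ite star, star_zero, ite_mul, zero_mul]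
    simp only [Matrix.trace, Matrix.diag_apply, Matrix.mul_apply, div_eq_mul_inv, ← h, hQ',
      Finset.sum_mul, Finset.mul_sum, RCLike.star_def, Complex.conj_ofReal]
    push_cast
    exact Finset.sum_congr rfl fun i _ => Finset.sum_congr rfl fun j _ => by ring
  rw [bornProb, e, Complex.ofReal_re]

lemma star_maxEntangled_dotProduct_self [Nonempty m] : star (maxEntangled m) ⬝ᵥ maxEntangled m = 1 := by
  have h : (√(Fintype.card m : ℝ))⁻¹ * (√(Fintype.card m : ℝ))⁻¹ = (Fintype.card m : ℝ)⁻¹ := by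
    rw [← mul_inv, Real.mul_self_sqrt (Nat.cast_nonneg _)]
  simp only [dotProduct, maxEntangled, Fintype.sum_prod_type, Pi.star_apply, mul_ite, mul_zero,
    Finset.sum_ite_eq, Finset.mem_univ, if_true, RCLike.star_def, Complex.conj_ofReal,
    ← Complex.ofReal_mul, h]
  simp

end MaxEntangled

/-- The spectral measurement of a Hermitian involution. -/
noncomputable def binaryMeasurement {m : Type*} [DecidableEq m] (U : Matrix m m ℂ) (a : Fin 2) :
    Matrix m m ℂ :=
  (2⁻¹ : ℂ) • (1 + (bitChar 1 a : ℂ) • U)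

section BinaryMeasurement

variable {m : Type*} [DecidableEq m]

lemma isProjectiveMeasurement_binaryMeasurement [Fintype m] {U : Matrix m m ℂ} (hU : U.conjTranspose = U)
    (hU1 : U * U = 1) : IsProjectiveMeasurement (binaryMeasurement U) := by
  refine ⟨fun a => ⟨?_, ?_⟩, ?_⟩
  · have h : (bitChar 1 a : ℂ) * bitChar 1 a = 1 := by
      rw [← Complex.ofReal_mul, bitChar_mul_self, Complex.ofReal_one]
    simp only [IsIdempotentElem, binaryMeasurement, Matrix.smul_mul, Matrix.mul_smul, mul_add,
      add_mul, hU1, mul_one, one_mul]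

    match_scalars
    · linear_combination (1 / 4 : ℂ) * h
    · ring
  · rw [IsSelfAdjoint, Matrix.star_eq_conjTranspose]
    simp [binaryMeasurement, hU]
  · simp only [Fin.sum_univ_two, binaryMeasurement, bitChar]
    simp
    module

lemma sum_bitChar_zero_smul_binaryMeasurement (U : Matrix m m ℂ) :
    ∑ a, (bitChar 0 a : ℂ) • binaryMeasurement U a = 1 := by
  simp only [Fin.sum_univ_two, binaryMeasurement, bitChar]
  simp
  module

lemma sum_bitChar_one_smul_binaryMeasurement (U : Matrix m m ℂ) :
    ∑ a, (bitChar 1 a : ℂ) • binaryMeasurement U a = U := by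
  simp only [Fin.sum_univ_two, binaryMeasurement, bitChar]
  simp
  module

end BinaryMeasurement

/-! ### Tensor powers of strategies -/

/-- The tensor product of a family of matrices. -/
def Matrix.piKronecker {ι m : Type*} [Fintype ι] (P : ι → Matrix m m ℂ) :
    Matrix (ι → m) (ι → m) ℂ :=
  Matrix.of fun i j => ∏ k, P k (i k) (j k)

section PiKronecker

variable {ι m : Type*} [Fintype ι]

lemma Matrix.piKronecker_mul [DecidableEq ι] [Fintype m] (P Q : ι → Matrix m m ℂ) :
    Matrix.piKronecker P * Matrix.piKronecker Q = Matrix.piKronecker fun k => P k * Q k := by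
  ext i j
  simp only [Matrix.piKronecker, Matrix.mul_apply, Matrix.of_apply, Fintype.prod_sum,
    Finset.prod_mul_distrib]

lemma Matrix.conjTranspose_piKronecker (P : ι → Matrix m m ℂ) :
    (Matrix.piKronecker P).conjTranspose = Matrix.piKronecker fun k => (P k).conjTranspose := by
  ext i j
  simp [Matrix.piKronecker]

lemma Matrix.piKronecker_one [DecidableEq m] : Matrix.piKronecker (fun _ : ι => (1 : Matrix m m ℂ)) = 1 := by
  ext i j
  simp [Matrix.piKronecker, Matrix.one_apply, Finset.prod_ite_zero, funext_iff]

lemma IsProjectiveMeasurement.piKronecker [DecidableEq ι] [Fintype m] [DecidableEq m]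
    {A : Type*} [Fintype A] {M : ι → A → Matrix m m ℂ} (hM : ∀ k, IsProjectiveMeasurement (M k)) :
    IsProjectiveMeasurement fun a : ι → A => Matrix.piKronecker fun k => M k (a k) := by
  refine ⟨fun a => ⟨?_, ?_⟩, ?_⟩
  · simp only [IsIdempotentElem, Matrix.piKronecker_mul, (hM _).mul_self]
  · simp only [IsSelfAdjoint, Matrix.star_eq_conjTranspose, Matrix.conjTranspose_piKronecker,
      (hM _).conjTranspose_eq]
  · rw [← Matrix.piKronecker_one]
    ext i j
    have h : ∀ k, (1 : Matrix m m ℂ) = ∑ a, M k a := fun k => (hM k).2.symm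
    simp only [Matrix.piKronecker, Matrix.sum_apply, Matrix.of_apply]
    rw [← Fintype.prod_sum fun k a => M k a (i k) (j k)]
    exact Finset.prod_congr rfl fun k _ => by rw [h k, Matrix.sum_apply]

/-- The tensor power of a bipartite state. -/
def piState (ι : Type*) [Fintype ι] {m : Type*} (ψ : m × m → ℂ) : (ι → m) × (ι → m) → ℂ :=
  fun p => ∏ k, ψ (p.1 k, p.2 k)

/-- Regroups the two provers' index tuples into a tuple of index pairs, one for each round, so that
sums over product states factor. -/
lemma sum_prod_arrow [DecidableEq ι] [Fintype m] (f : ι → m × m → ℂ) :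
    ∑ p : (ι → m) × (ι → m), ∏ k, f k (p.1 k, p.2 k) = ∏ k, ∑ p, f k p := by
  rw [Fintype.prod_sum, ← (Equiv.arrowProdEquivProdArrow ι (fun _ => m) (fun _ => m)).sum_comp]
  rfl

lemma star_piState_dotProduct_self [DecidableEq ι] [Fintype m] {ψ : m × m → ℂ} (hψ : star ψ ⬝ᵥ ψ = 1) :
    star (piState ι ψ) ⬝ᵥ piState ι ψ = 1 := by
  simp only [dotProduct, Pi.star_apply] at hψ
  simp only [dotProduct, piState, Pi.star_apply, star_prod, ← Finset.prod_mul_distrib]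
  rw [sum_prod_arrow fun _ p => star (ψ p) * ψ p]
  simp only [hψ, Finset.prod_const_one]

/-- Taking real parts is not multiplicative, so the factorization over rounds needs each expectation
to be real already. -/
lemma ofReal_bornProb [Fintype m] (ψ : m × m → ℂ) {P Q : Matrix m m ℂ} (hP : P.conjTranspose = P)
    (hQ : Q.conjTranspose = Q) :
    (bornProb ψ P Q : ℂ) = star ψ ⬝ᵥ ((P ⊗ₖ Q).mulVec ψ) := by
  have h : (P ⊗ₖ Q).IsHermitian := by
    rw [Matrix.IsHermitian, Matrix.conjTranspose_kronecker, hP, hQ]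
  exact Complex.ext rfl (h.im_star_dotProduct_mulVec_self ψ).symm

lemma bornProb_piState [DecidableEq ι] [Fintype m] (ψ : m × m → ℂ) {P Q : ι → Matrix m m ℂ}
    (hP : ∀ k, (P k).conjTranspose = P k) (hQ : ∀ k, (Q k).conjTranspose = Q k) :
    bornProb (piState ι ψ) (Matrix.piKronecker P) (Matrix.piKronecker Q) =
      ∏ k, bornProb ψ (P k) (Q k) := by
  have h : star (piState ι ψ) ⬝ᵥ
      ((Matrix.piKronecker P ⊗ₖ Matrix.piKronecker Q).mulVec (piState ι ψ)) =
      ∏ k, star ψ ⬝ᵥ ((P k ⊗ₖ Q k).mulVec ψ) := by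
    simp only [dotProduct, Matrix.mulVec, Pi.star_apply]
    rw [← sum_prod_arrow fun k p => star (ψ p) * ∑ q, (P k ⊗ₖ Q k) p q * ψ q]
    refine Finset.sum_congr rfl fun p _ => ?_
    rw [Finset.prod_mul_distrib, piState, star_prod,
      ← sum_prod_arrow fun k q => (P k ⊗ₖ Q k) (p.1 k, p.2 k) q * ψ q]
    simp only [Finset.prod_mul_distrib, piState, Matrix.kroneckerMap_apply, Matrix.piKronecker,
      Matrix.of_apply]
  rw [bornProb, h]
  simp only [← ofReal_bornProb ψ (hP _) (hQ _), ← Complex.ofReal_prod, Complex.ofReal_re]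

end PiKronecker

/-! ### The two lower bounds and the conclusion -/

namespace TwoProverGame

variable {X Y : Type*} [Fintype X] [Fintype Y]

/-- Playing the rounds independently. -/
lemma entangledValue_pow_le {A B : Type*} [Fintype A] [Fintype B] [Nonempty A] [Nonempty B]
    (G : TwoProverGame X Y A B) (N : ℕ) :
    G.entangledValue ^ N ≤ (G.parallelRep N).entangledValue := by
  refine le_of_tendsto (G.tendsto_valueAt.pow N) ?_
  filter_upwards [Filter.eventually_ge_atTop 1] with d hd
  obtain ⟨ψ, P, Q, hψ, hP, hQ, h⟩ := (G.isGreatest_valueAt hd).1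
  rw [h]
  refine le_of_eq_of_le ?_ ((G.parallelRep N).le_entangledValue_of_fintype
    (star_piState_dotProduct_self (ι := Fin N) hψ)
    (fun x => IsProjectiveMeasurement.piKronecker fun k => hP (x k))
    (fun y => IsProjectiveMeasurement.piKronecker fun k => hQ (y k)))
  have hV : ∀ x y a b, (if (G.parallelRep N).V a b x y then (1 : ℝ) else 0) =
      ∏ i, if G.V (a i) (b i) (x i) (y i) then 1 else 0 := by
    intro x y a b
    simp [parallelRep, Finset.prod_ite_zero]
  simp only [bornProb_piState ψ (fun k => (hP _).conjTranspose_eq _)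
    (fun k => (hQ _).conjTranspose_eq _), hV, ← Finset.prod_mul_distrib]
  have e : G.winProb ψ P Q ^ N = ∏ _i : Fin N, G.winProb ψ P Q := by simp
  rw [e]
  simp only [winProb, Fintype.prod_sum, Finset.prod_mul_distrib, parallelRep]

/-- The value of an XOR game is at least the vector-valued optimum: unit vectors are turned into
observables on a maximally entangled state. -/
lemma IsXOR.le_entangledValue {G : TwoProverGame X Y (Fin 2) (Fin 2)} (hG : G.IsXOR) {n : ℕ}
    {u : X → EuclideanSpace ℝ (Fin n)} {v : Y → EuclideanSpace ℝ (Fin n)} (hu : ∀ x, ‖u x‖ = 1)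
    (hv : ∀ y, ‖v y‖ = 1) :
    ∑ x, ∑ y, G.xorCoeff 0 x y + ∑ x, ∑ y, G.xorCoeff 1 x y * inner ℝ (u x) (v y) ≤
      G.entangledValue := by
  obtain ⟨m, _, _, _, U, hUs, hU1, hUt⟩ := exists_observables n
  have hUh : ∀ w, ((U w).map Complex.ofReal).conjTranspose = (U w).map Complex.ofReal := by
    intro w
    ext i j
    simpa using congrFun₂ (hUs w) i j
  have hUsq : ∀ w, ‖w‖ = 1 → (U w).map Complex.ofReal * (U w).map Complex.ofReal = 1 := by
    intro w hw
    have := congrArg (fun Z : Matrix m m ℝ => Z.map Complex.ofRealHom) (hU1 w hw)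
    rw [Matrix.map_mul] at this
    exact this.trans (Matrix.map_one _ (map_zero _) (map_one _))
  have hcard : (Fintype.card m : ℝ) ≠ 0 := Nat.cast_ne_zero.2 Fintype.card_ne_zero
  have h1 : bornProb (maxEntangled m) 1 1 = 1 := by
    simp [bornProb, star_maxEntangled_dotProduct_self]
  refine le_of_eq_of_le ?_ (G.le_entangledValue_of_fintype
    (star_maxEntangled_dotProduct_self (m := m))
    (fun x => isProjectiveMeasurement_binaryMeasurement (hUh (u x)) (hUsq _ (hu x)))
    (fun y => isProjectiveMeasurement_binaryMeasurement (hUh (v y)) (hUsq _ (hv y))))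
  -- For the trivial character both observables are the identity, with expectation 1; for the other
  -- they are the involutions of `u x` and `v y`, whose normalized trace is the inner product.
  rw [hG.sum_eq, Fin.sum_univ_two]
  simp only [sum_bitChar_zero_smul_binaryMeasurement, sum_bitChar_one_smul_binaryMeasurement, h1,
    mul_one, bornProb_maxEntangled _ _ (hUs _), hUt, mul_div_cancel_left₀ _ hcard]

end TwoProverGame

theorem mainTheorem5 {X Y : Type*} [Fintype X] [Fintype Y]
    (G : TwoProverGame X Y (Fin 2) (Fin 2)) (hG : G.IsXOR) (N : ℕ) :
    (G.parallelRep N).entangledValue = G.entangledValue ^ N := by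
  refine le_antisymm ?_ (G.entangledValue_pow_le N)
  obtain ⟨n, u, v, hu, hv, hK⟩ := exists_unit_vectors_isBilinBound (G.xorCoeff 1)
  -- The marginals of `R s` are the certificate for character `s`, and the total of `R 0` and `R 1`
  -- is the vector-valued optimum.
  let R : Fin 2 → X → Y → ℝ := ![G.xorCoeff 0, fun x y => G.xorCoeff 1 x y * inner ℝ (u x) (v y)]
  have hR : ∀ s, IsBilinBound (G.xorCoeff s) (fun x => ∑ y, R s x y) (fun y => ∑ x, R s x y) :=
    Fin.forall_fin_two.2 ⟨IsBilinBound.of_nonneg G.xorCoeff_zero_nonneg, hK⟩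
  have hup := hG.entangledValue_parallelRep_le hR (fun s => rfl) (fun s => Finset.sum_comm) N
  have hlow := hG.le_entangledValue hu hv
  have hsum : ∑ s, ∑ x, ∑ y, R s x y = ∑ x, ∑ y, G.xorCoeff 0 x y +
      ∑ x, ∑ y, G.xorCoeff 1 x y * inner ℝ (u x) (v y) := Fin.sum_univ_two _
  have h0 : 0 ≤ ∑ s, ∑ x, ∑ y, R s x y := by
    -- Testing the constraint at `a = 1`, `b = 0` shows that the total is nonnegative, as needed for
    -- monotonicity of the `N`-th power.
    have h1 := hR 1 (fun _ => 1) (fun _ => 0)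
    simp only [mul_zero, Finset.sum_const_zero, one_pow, mul_one, ne_eq, OfNat.ofNat_ne_zero,
      not_false_eq_true, zero_pow, add_zero] at h1
    rw [Fin.sum_univ_two]
    exact add_nonneg (Finset.sum_nonneg fun x _ => Finset.sum_nonneg fun y _ =>
      G.xorCoeff_zero_nonneg x y) h1
  exact hup.trans (pow_le_pow_left₀ h0 (hsum.trans_le hlow) N)
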